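/- Let $I=[0,1]\cap\mathbb Z[\tfrac12]$ and let $X$ be the $\mathbb Q$-vector space of functions $I\to\mathbb Q$. For $\alpha\in X$ put $(T_0\alpha)(t)=\alpha(\tfrac t2)$ and $(T_1\alpha)(t)=\alpha(\tfrac{1+t}2)$. The product $\alpha\#\beta\in X$ of $\alpha,\beta\in X$ is defined by recursion on the denominator of the argument: $\alpha\#\beta(0)=0$, $\alpha\#\beta(1)=(\alpha(1)-\alpha(0))(\beta(1)-\beta(0))$, $$\alpha\#\beta(t)=T_0\alpha\#T_0\beta\,(2t)+T_1\alpha\#T_1\beta\,(2t)\qquad(0\le t\le\tfrac12),$$ $$\alpha\#\beta(t)=T_0\alpha\#T_0\beta\,(1)+T_1\alpha\#T_1\beta\,(1)+T_0\alpha\#T_1\beta\,(2t-1)+T_1\alpha\#T_0\beta\,(2t-1)\qquad(\tfrac12\le t\le1).$$ Let $\epsilon\in X$ be $\epsilon(t)=t-t^2$, and define $\phi_0,\phi_1,\phi_2,\dots\in X$ by recursion on the denominator of the argument: $\phi_m(0)=\phi_m(1)=0$; for $0\le t\le\tfrac12$, $$8\phi_m(t)=\begin{cases}\phi_{m+1}(2t)+(8m+6)t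 & (m \text{ even}),\\ \phi_{m-1}(2t)+\epsilon(2t)+(8m+6)t & (m\text{ odd});\end{cases}$$ and for $\tfrac12\le t\le1$, $$8\phi_m(t)=\begin{cases}\phi_0(2t-1)+6(1-t) & (m=0),\\ \phi_{m-1}(2t-1)+\epsilon(2t-1)+(8m+6)(1-t) & (m\ne0\text{ even}),\\ \phi_{m+1}(2t-1)+(8m+6)(1-t) & (m\text{ odd}).\end{cases}$$ **Theorem 2.4.** Let $E_1=\epsilon\#\phi_0$. Then $$\lim_{n\to\infty}2^nE_1(2^{-n})=\frac13+\frac5{14\sqrt7}.$$ Moreover, let $F$ be a field of characteristic $2$. For a power series $f\neq0$ in the maximal ideal of $F[[u_1,\dots,u_r]]$ let $\phi_f\in X$ be the function $\phi_f(i/q)=q^{-r}\dim_F F[[u_1,\dots,u_r]]/(u_1^q,\dots,u_r^q,f^i)$, $q$ a power of $2$ (it is well defined), and let $\mu(f)=\lim_{q=2^n\to\infty}q^{-(r-1)}\dim_F F[[u_1,\dots,u_r]]/(u_1^q,\dots,u_r^q,f)$ be the Hilbert–Kunz multiplicity of $f$. Suppose that the following conjecture (Conjecture 2.3) holds over $F$: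 for $f=x^3+y^3+xyz\in F[[x,y,z]]$ one has $\phi_f(t)=t+\phi_0(t)$ for all $t\in I$. Then the Hilbert–Kunz multiplicity of $uv+x^3+y^3+xyz\in F[[u,v,x,y,z]]$ is $$\mu(uv+x^3+y^3+xyz)=\frac43+\frac5{14\sqrt7}.$$ -/

import Mathlib

open Filter Topology

namespace HilbertKunz

/-- The set `I = [0,1] ∩ ℤ[1/2]` of dyadic rationals in the unit interval. -/
def dyadicUnit : Set ℚ := {t | 0 ≤ t ∧ t ≤ 1 ∧ ∃ (k : ℤ) (n : ℕ), t = k / 2 ^ n}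

/-- The vector space `X` of all functions `I → ℚ`. -/
abbrev X : Type := dyadicUnit → ℚ

/-- The points `0`, `1` and `2⁻ⁿ` of `I`. -/
def zeroPt : dyadicUnit := ⟨0, le_refl 0, zero_le_one, 0, 0, by norm_num⟩

def onePt : dyadicUnit := ⟨1, zero_le_one, le_refl 1, 1, 0, by norm_num⟩

def invTwoPow (n : ℕ) : dyadicUnit :=
  ⟨1 / 2 ^ n, by positivity, by
    rw [div_le_one (by positivity)]
    exact one_le_pow₀ (by norm_num), 1, n, by norm_num⟩

/-- `t ↦ t / 2`. -/
def half (t : dyadicUnit) : dyadicUnit :=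
  ⟨t.1 / 2, by
    obtain ⟨t, h0, h1, k, n, h⟩ := t
    exact ⟨by simp only; linarith, by simp only; linarith, k, n + 1, by
      simp only [h, pow_succ]; field_simp⟩⟩

/-- `t ↦ (1 + t) / 2`. -/
def halfAdd (t : dyadicUnit) : dyadicUnit :=
  ⟨(1 + t.1) / 2, by
    obtain ⟨t, h0, h1, k, n, h⟩ := t
    exact ⟨by simp only; linarith, by simp only; linarith, k + 2 ^ n, n + 1, by
      simp only [h, pow_succ]; push_cast; field_simp; ring⟩⟩

/-- `t ↦ 2t`, for `t ≤ 1/2`. -/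
def dbl (t : dyadicUnit) (ht : t.1 ≤ 1 / 2) : dyadicUnit :=
  ⟨2 * t.1, by
    obtain ⟨t, h0, h1, k, n, h⟩ := t
    simp only at ht
    exact ⟨by simp only; linarith, by simp only; linarith, 2 * k, n, by
      simp only [h]; push_cast; ring⟩⟩

/-- `t ↦ 2t - 1`, for `1/2 ≤ t`. -/
def dblSub (t : dyadicUnit) (ht : 1 / 2 ≤ t.1) : dyadicUnit :=
  ⟨2 * t.1 - 1, by
    obtain ⟨t, h0, h1, k, n, h⟩ := t
    simp only at ht
    exact ⟨by simp only; linarith, by simp only; linarith, 2 * k - 2 ^ n, n, by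
      simp only [h]; push_cast; field_simp⟩⟩

lemma exists_den_eq (t : dyadicUnit) (h0 : t ≠ zeroPt) (h1 : t ≠ onePt) :
    ∃ m : ℕ, t.1.den = 2 ^ (m + 1) := by
  obtain ⟨t, hn, hl, k, n, h⟩ := t
  have h0' : t ≠ 0 := fun e => h0 (Subtype.ext e)
  have h1' : t ≠ 1 := fun e => h1 (Subtype.ext e)
  have hd : t.den ∣ 2 ^ n := by
    have := Rat.den_dvd k (2 ^ n)
    rw [Rat.divInt_eq_div] at this
    push_cast at this
    rw [← h] at this
    exact_mod_cast this
  obtain ⟨m, -, hm⟩ := (Nat.dvd_prime_pow Nat.prime_two).1 hd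
  cases m with
  | succ m => exact ⟨m, hm⟩
  | zero =>
    exfalso
    have e : t = t.num := by
      conv_lhs => rw [← Rat.num_div_den t, hm]
      simp
    rw [e] at hn hl h0' h1'
    norm_cast at hn hl h0' h1'
    omega

lemma den_lt_of_eq {s t : dyadicUnit} (h0 : t ≠ zeroPt) (h1 : t ≠ onePt) (c : ℤ)
    (hs : s.1 = 2 * t.1 - c) : s.1.den < t.1.den := by
  obtain ⟨m, hm⟩ := exists_den_eq t h0 h1
  have e : s.1 = Rat.divInt (t.1.num - c * 2 ^ m) (2 ^ m) := by
    rw [hs, Rat.divInt_eq_div]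
    conv_lhs => rw [← Rat.num_div_den t.1, hm]
    push_cast
    field_simp
    ring
  have hd : s.1.den ∣ 2 ^ m := by
    have := Rat.den_dvd (t.1.num - c * 2 ^ m) (2 ^ m)
    rw [← e] at this
    exact_mod_cast this
  rw [hm, pow_succ]
  have := Nat.le_of_dvd (by positivity) hd
  have : 0 < 2 ^ m := by positivity
  omega

lemma den_dbl_lt {t : dyadicUnit} (h0 : t ≠ zeroPt) (h1 : t ≠ onePt) (ht : t.1 ≤ 1 / 2) :
    (dbl t ht).1.den < t.1.den :=
  den_lt_of_eq h0 h1 0 (by simp [dbl])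

lemma den_dblSub_lt {t : dyadicUnit} (h0 : t ≠ zeroPt) (h1 : t ≠ onePt) (ht : 1 / 2 ≤ t.1) :
    (dblSub t ht).1.den < t.1.den :=
  den_lt_of_eq h0 h1 1 (by simp [dblSub])

lemma den_onePt_lt {t : dyadicUnit} (h0 : t ≠ zeroPt) (h1 : t ≠ onePt) :
    onePt.1.den < t.1.den := by
  obtain ⟨m, hm⟩ := exists_den_eq t h0 h1
  rw [hm]
  exact Nat.one_lt_two_pow (by omega)

/-- `T₀ α` is `t ↦ α (t / 2)`. -/
def T₀ (α : X) : X := fun t => α (half t)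

/-- `T₁ α` is `t ↦ α ((1 + t) / 2)`. -/
def T₁ (α : X) : X := fun t => α (halfAdd t)

/-- The product `α # β` on `X`, by recursion on the denominator of the argument. -/
def sharp (α β : X) (t : dyadicUnit) : ℚ :=
  if h0 : t = zeroPt then 0
  else if h1 : t = onePt then (α onePt - α zeroPt) * (β onePt - β zeroPt)
  else if h : t.1 ≤ 1 / 2 then
    sharp (T₀ α) (T₀ β) (dbl t h) + sharp (T₁ α) (T₁ β) (dbl t h)
  else
    sharp (T₀ α) (T₀ β) onePt + sharp (T₁ α) (T₁ β) onePt
      + sharp (T₀ α) (T₁ β) (dblSub t (le_of_not_ge h))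
      + sharp (T₁ α) (T₀ β) (dblSub t (le_of_not_ge h))
termination_by t.1.den
decreasing_by
  · exact den_dbl_lt h0 h1 h
  · exact den_dbl_lt h0 h1 h
  · exact den_onePt_lt h0 h1
  · exact den_onePt_lt h0 h1
  · exact den_dblSub_lt h0 h1 _
  · exact den_dblSub_lt h0 h1 _

/-- The identity function `t ↦ t` in `X`. -/
def idFun : X := fun t => t.1

/-- The function `ε : t ↦ t - t²` in `X`. -/
def eps : X := fun t => t.1 - t.1 ^ 2

/-- The functions `φ₀, φ₁, φ₂, …` in `X`, by recursion on the denominator of the argument. -/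
def phi (m : ℕ) (t : dyadicUnit) : ℚ :=
  if h0 : t = zeroPt then 0
  else if h1 : t = onePt then 0
  else if h : t.1 ≤ 1 / 2 then
    if Even m then
      (phi (m + 1) (dbl t h) + (8 * m + 6) * t.1) / 8
    else
      (phi (m - 1) (dbl t h) + eps (dbl t h) + (8 * m + 6) * t.1) / 8
  else
    if m = 0 then
      (phi 0 (dblSub t (le_of_not_ge h)) + 6 * (1 - t.1)) / 8
    else if Even m then
      (phi (m - 1) (dblSub t (le_of_not_ge h)) + eps (dblSub t (le_of_not_ge h))
        + (8 * m + 6) * (1 - t.1)) / 8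
    else
      (phi (m + 1) (dblSub t (le_of_not_ge h)) + (8 * m + 6) * (1 - t.1)) / 8
termination_by t.1.den
decreasing_by
  · exact den_dbl_lt h0 h1 h
  · exact den_dbl_lt h0 h1 h
  · exact den_dblSub_lt h0 h1 _
  · exact den_dblSub_lt h0 h1 _
  · exact den_dblSub_lt h0 h1 _

/-- `E₁ = ε # φ₀`. -/
def E₁ : X := sharp eps (phi 0)

section PowerSeries

variable {σ F : Type*} [Fintype σ] [Field F]

/-- The colength `deg (u₁^q, …, u_r^q, g)` in `F[[u₁, …, u_r]]`, as the dimension of the quotient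
over the residue field `F`; the quotient is finite-dimensional for `q > 0`. -/
noncomputable def deg (q : ℕ) (g : MvPowerSeries σ F) : ℕ :=
  Module.finrank F (MvPowerSeries σ F ⧸
    (Ideal.span (Set.range fun j : σ => (MvPowerSeries.X j : MvPowerSeries σ F) ^ q)
      ⊔ Ideal.span {g}))

/-- The function `φ_f : i/q ↦ q^{-r} deg (u₁^q, …, u_r^q, f^i)` in `X`, where `r` is the number
of variables and `i/q` is taken in lowest terms (so that `q` is a power of `2`). -/
noncomputable def hkFun (f : MvPowerSeries σ F) : X := fun t =>
  (deg t.1.den (f ^ t.1.num.toNat) : ℚ) / (t.1.den : ℚ) ^ Fintype.card σ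

/-- `μ` is the Hilbert-Kunz multiplicity of `f`, a nonzero nonunit power series in `r` variables
over a field of characteristic `2`: the limit of `q^{-(r-1)} deg (u₁^q, …, u_r^q, f)` over the
powers `q = 2ⁿ`. -/
def HasHKMultiplicity (f : MvPowerSeries σ F) (μ : ℝ) : Prop :=
  Tendsto (fun n : ℕ => (deg (2 ^ n) f : ℝ) / ((2 : ℝ) ^ n) ^ (Fintype.card σ - 1)) atTop (𝓝 μ)

end PowerSeries

/-- The nodal cubic `x³ + y³ + xyz` in `F[[x, y, z]]`. -/
noncomputable def nodalCubic (F : Type*) [Field F] : MvPowerSeries (Fin 3) F :=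
  let x := MvPowerSeries.X 0
  let y := MvPowerSeries.X 1
  let z := MvPowerSeries.X 2
  x ^ 3 + y ^ 3 + x * y * z

/-- The element `uv + x³ + y³ + xyz` of `F[[u, v, x, y, z]]`. -/
noncomputable def uvNodalCubic (F : Type*) [Field F] : MvPowerSeries (Fin 5) F :=
  let u := MvPowerSeries.X 0
  let v := MvPowerSeries.X 1
  let x := MvPowerSeries.X 2
  let y := MvPowerSeries.X 3
  let z := MvPowerSeries.X 4
  u * v + x ^ 3 + y ^ 3 + x * y * z

/-- The conjecture on the nodal cubic over `F`: `φ_f = t + φ₀` for `f = x³ + y³ + xyz`. -/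
def NodalCubicConjecture (F : Type*) [Field F] : Prop :=
  hkFun (nodalCubic F) = idFun + phi 0

end HilbertKunz

/-!
The Riemann sums `2⁻ⁿ ∑ φ(k/2ⁿ)` carry both claims. Since `ε # β (2⁻ⁿ)` unfolds to the sum of the
products of the increments of `ε` and `β` over the grid of mesh `2⁻ⁿ`, Abel summation makes
`2ⁿ E₁(2⁻ⁿ)` twice the Riemann sum of `φ₀`. The functional equations give the Riemann sums of the
`φ_m` a three-term recursion in `m`, contracting towards its only solution of at most linear growth
in `m`, which is explicit in terms of the root `8 - 3√7` of `ρ² - 16ρ + 1`.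

Modulo `uv - f`, where `f` does not involve `u` and `v`, a power series splits along the diagonals
`uᵃ⁺ʲ vᵇ⁺ʲ`, and the diagonal meeting the exponents below `q` in `k` points contributes the colength
of `fᵏ`. Each `k < q` occurs on two diagonals, so `μ(uv - f)` is twice the limit of the Riemann sums
of `φ_f`; in characteristic `2`, `uv - f = uv + f`.
-/

namespace HilbertKunz

/-- The point `k / 2ⁿ` of `I`; indices `k > 2ⁿ` are truncated to `2ⁿ` to stay in `[0, 1]`. -/
def dyadicPt (n k : ℕ) : dyadicUnit :=
  ⟨(min k (2 ^ n) : ℕ) / 2 ^ n, by positivity, by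
    rw [div_le_one (by positivity)]
    exact_mod_cast min_le_right _ _, (min k (2 ^ n) : ℕ), n, by push_cast; rfl⟩

section Points

variable {n k : ℕ} (t : dyadicUnit)

lemma coe_dyadicPt (h : k ≤ 2 ^ n) : (dyadicPt n k).1 = k / 2 ^ n := by
  simp [dyadicPt, min_eq_left h]

lemma dyadicPt_zero : dyadicPt n 0 = zeroPt :=
  Subtype.ext (by rw [coe_dyadicPt (Nat.zero_le _)]; simp [zeroPt])

lemma dyadicPt_two_pow : dyadicPt n (2 ^ n) = onePt :=
  Subtype.ext (by rw [coe_dyadicPt le_rfl]; simp [onePt])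

lemma half_dyadicPt (h : k ≤ 2 ^ n) : half (dyadicPt n k) = dyadicPt (n + 1) k :=
  Subtype.ext (by
    have h' : k ≤ 2 ^ (n + 1) := by rw [pow_succ]; omega
    rw [coe_dyadicPt h']
    simp only [half, coe_dyadicPt h, pow_succ]
    field_simp)

lemma halfAdd_dyadicPt (h : k ≤ 2 ^ n) :
    halfAdd (dyadicPt n k) = dyadicPt (n + 1) (2 ^ n + k) :=
  Subtype.ext (by
    have h' : 2 ^ n + k ≤ 2 ^ (n + 1) := by rw [pow_succ]; omega
    rw [coe_dyadicPt h']
    simp only [halfAdd, coe_dyadicPt h, pow_succ]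
    push_cast
    field_simp)

lemma dyadicPt_two_mul (h : k ≤ 2 ^ n) : dyadicPt (n + 1) (2 * k) = dyadicPt n k :=
  Subtype.ext (by
    rw [coe_dyadicPt h, coe_dyadicPt (by rw [pow_succ]; omega), pow_succ]
    push_cast
    field_simp)

lemma half_le : (half t).1 ≤ 1 / 2 := by
  have := t.2.2.1
  simp only [half]
  linarith

lemma le_halfAdd : 1 / 2 ≤ (halfAdd t).1 := by
  have := t.2.1
  simp only [halfAdd]
  linarith

lemma dbl_half : dbl (half t) (half_le t) = t :=
  Subtype.ext (by simp only [dbl, half]; ring)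

lemma dblSub_halfAdd : dblSub (halfAdd t) (le_halfAdd t) = t :=
  Subtype.ext (by simp only [dblSub, halfAdd]; ring)

lemma half_eq_zeroPt_iff : half t = zeroPt ↔ t = zeroPt := by
  simp [half, zeroPt, Subtype.ext_iff]

lemma half_ne_onePt : half t ≠ onePt := fun e => by
  have := half_le t
  rw [e] at this
  norm_num [onePt] at this

lemma halfAdd_ne_zeroPt : halfAdd t ≠ zeroPt := fun e => by
  have := le_halfAdd t
  rw [e] at this
  norm_num [zeroPt] at this

lemma halfAdd_eq_onePt_iff : halfAdd t = onePt ↔ t = onePt := by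
  simp only [halfAdd, onePt, Subtype.ext_iff]
  constructor <;> intro h <;> linarith

lemma halfAdd_le_iff : (halfAdd t).1 ≤ 1 / 2 ↔ t = zeroPt := by
  have := t.2.1
  simp only [halfAdd, zeroPt, Subtype.ext_iff]
  constructor <;> intro h <;> linarith

lemma halfAdd_zeroPt : halfAdd zeroPt = half onePt :=
  Subtype.ext (by simp [halfAdd, half, zeroPt, onePt])

lemma invTwoPow_zero : invTwoPow 0 = onePt := Subtype.ext (by simp [invTwoPow, onePt])

lemma invTwoPow_succ : invTwoPow (n + 1) = half (invTwoPow n) :=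
  Subtype.ext (by simp only [invTwoPow, half, pow_succ]; field_simp)

lemma invTwoPow_ne_zeroPt : invTwoPow n ≠ zeroPt := fun e => by
  have := congrArg Subtype.val e
  simp [invTwoPow, zeroPt] at this

end Points

section FunctionalEquations

variable (m : ℕ) (t : dyadicUnit) (α β : X)

lemma sharp_onePt : sharp α β onePt = (α onePt - α zeroPt) * (β onePt - β zeroPt) := by
  have h0 : onePt ≠ zeroPt := invTwoPow_zero ▸ invTwoPow_ne_zeroPt
  rw [sharp, dif_neg h0, dif_pos rfl]

lemma sharp_half (h : t ≠ zeroPt) :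
    sharp α β (half t) = sharp (T₀ α) (T₀ β) t + sharp (T₁ α) (T₁ β) t := by
  rw [sharp, dif_neg (mt (half_eq_zeroPt_iff t).1 h), dif_neg (half_ne_onePt t),
    dif_pos (half_le t), dbl_half]

lemma phi_zeroPt : phi m zeroPt = 0 := by rw [phi, dif_pos rfl]

lemma phi_onePt : phi m onePt = 0 := by rw [phi]; simp

lemma eps_zeroPt : eps zeroPt = 0 := by simp [eps, zeroPt]

lemma eps_onePt : eps onePt = 0 := by simp [eps, onePt]

lemma idFun_zeroPt : idFun zeroPt = 0 := rfl

lemma idFun_onePt : idFun onePt = 1 := rfl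

lemma phi_half : phi m (half t) =
    ((if Even m then phi (m + 1) t else phi (m - 1) t + eps t) + (4 * m + 3) * idFun t) / 8 := by
  rcases eq_or_ne t zeroPt with rfl | ht
  · simp [(half_eq_zeroPt_iff zeroPt).2 rfl, phi_zeroPt, eps_zeroPt, idFun_zeroPt]
  · have hval : (half t).1 = idFun t / 2 := rfl
    rw [phi, dif_neg (mt (half_eq_zeroPt_iff t).1 ht), dif_neg (half_ne_onePt t),
      dif_pos (half_le t), dbl_half, hval]
    split_ifs <;> ring

lemma phi_halfAdd : phi m (halfAdd t) =
    ((if m = 0 then phi 0 t else if Even m then phi (m - 1) t + eps t else phi (m + 1) t)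
      + (4 * m + 3) * (1 - idFun t)) / 8 := by
  rcases eq_or_ne t onePt with rfl | h1
  · simp [(halfAdd_eq_onePt_iff onePt).2 rfl, phi_onePt, eps_onePt, idFun_onePt]
  rcases eq_or_ne t zeroPt with rfl | h0
  · rw [halfAdd_zeroPt, phi_half]
    simp [phi_zeroPt, eps_zeroPt, phi_onePt, eps_onePt, idFun_zeroPt, idFun_onePt]
  · have hval : (halfAdd t).1 = (1 + idFun t) / 2 := rfl
    rw [phi, dif_neg (halfAdd_ne_zeroPt t), dif_neg (mt (halfAdd_eq_onePt_iff t).1 h1),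
      dif_neg (mt (halfAdd_le_iff t).1 h0), dblSub_halfAdd, hval]
    rcases eq_or_ne m 0 with rfl | hm
    · simp only [if_true]; push_cast; ring
    · simp only [hm, if_false]
      split_ifs <;> ring

lemma T₀_idFun_add_T₁_idFun : T₀ idFun + T₁ idFun = idFun + (1 / 2 : ℚ) • 1 := by
  ext t
  simp only [T₀, T₁, idFun, half, halfAdd, Pi.add_apply, Pi.smul_apply, Pi.one_apply, smul_eq_mul]
  ring

lemma T₀_eps_add_T₁_eps : T₀ eps + T₁ eps = (1 / 2 : ℚ) • eps + (1 / 4 : ℚ) • 1 := by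
  ext t
  simp only [T₀, T₁, eps, half, halfAdd, Pi.add_apply, Pi.smul_apply, Pi.one_apply, smul_eq_mul]
  ring

lemma T₀_phi_zero_add_T₁_phi_zero :
    T₀ (phi 0) + T₁ (phi 0) = (1 / 8 : ℚ) • (phi 1 + phi 0 + (3 : ℚ) • 1) := by
  ext t
  simp only [T₀, T₁, phi_half, phi_halfAdd, Even.zero, if_true, Pi.add_apply, Pi.smul_apply,
    Pi.one_apply, smul_eq_mul]
  push_cast
  ring

lemma T₀_phi_succ_add_T₁_phi_succ :
    T₀ (phi (m + 1)) + T₁ (phi (m + 1))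
      = (1 / 8 : ℚ) • (phi (m + 2) + phi m + eps + (4 * m + 7 : ℚ) • 1) := by
  ext t
  simp only [T₀, T₁, phi_half, phi_halfAdd, m.succ_ne_zero, if_false, Nat.add_sub_cancel,
    Pi.add_apply, Pi.smul_apply, Pi.one_apply, smul_eq_mul]
  push_cast
  split_ifs <;> ring

end FunctionalEquations

/-- The average of `α` over the points `k / 2ⁿ`, `0 ≤ k < 2ⁿ`: a Riemann sum for `∫₀¹ α`. -/
def dyadicMean (n : ℕ) : X →ₗ[ℚ] ℚ :=
  (2 ^ n : ℚ)⁻¹ • ∑ k ∈ Finset.range (2 ^ n), LinearMap.proj (dyadicPt n k)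

section DyadicMean

variable (m n : ℕ) (α β : X)

lemma dyadicMean_apply :
    dyadicMean n α = (∑ k ∈ Finset.range (2 ^ n), α (dyadicPt n k)) / 2 ^ n := by
  simp [dyadicMean, div_eq_inv_mul]

lemma dyadicMean_zero : dyadicMean 0 α = α zeroPt := by
  simp [dyadicMean_apply, dyadicPt_zero]

lemma dyadicMean_succ : dyadicMean (n + 1) α = dyadicMean n (T₀ α + T₁ α) / 2 := by
  have hsum : ∑ k ∈ Finset.range (2 ^ (n + 1)), α (dyadicPt (n + 1) k)
      = ∑ k ∈ Finset.range (2 ^ n), (T₀ α + T₁ α) (dyadicPt n k) := by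
    rw [pow_succ, mul_two, Finset.sum_range_add, ← Finset.sum_add_distrib]
    refine Finset.sum_congr rfl fun k hk => ?_
    have hk := (Finset.mem_range.1 hk).le
    rw [Pi.add_apply, T₀, T₁, half_dyadicPt hk, halfAdd_dyadicPt hk]
  rw [dyadicMean_apply, dyadicMean_apply, hsum, pow_succ, div_div]

lemma dyadicMean_one : dyadicMean n 1 = 1 := by
  simp [dyadicMean_apply]

lemma dyadicMean_idFun : dyadicMean n idFun = (1 - (1 / 2) ^ n) / 2 := by
  induction n with
  | zero => simp [dyadicMean_zero, idFun_zeroPt]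
  | succ n ih =>
    rw [dyadicMean_succ, T₀_idFun_add_T₁_idFun, map_add, map_smul, ih, dyadicMean_one]
    simp only [smul_eq_mul]
    ring

lemma dyadicMean_eps : dyadicMean n eps = (1 - (1 / 4) ^ n) / 6 := by
  induction n with
  | zero => simp [dyadicMean_zero, eps_zeroPt]
  | succ n ih =>
    rw [dyadicMean_succ, T₀_eps_add_T₁_eps, map_add, map_smul, map_smul, ih, dyadicMean_one]
    simp only [smul_eq_mul]
    ring

lemma dyadicMean_succ_phi_zero :
    dyadicMean (n + 1) (phi 0) = (dyadicMean n (phi 1) + dyadicMean n (phi 0) + 3) / 16 := by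
  rw [dyadicMean_succ, T₀_phi_zero_add_T₁_phi_zero]
  simp only [map_add, map_smul, dyadicMean_one, smul_eq_mul]
  ring

lemma dyadicMean_succ_phi_succ :
    dyadicMean (n + 1) (phi (m + 1)) =
      (dyadicMean n (phi (m + 2)) + dyadicMean n (phi m) + dyadicMean n eps + (4 * m + 7))
        / 16 := by
  rw [dyadicMean_succ, T₀_phi_succ_add_T₁_phi_succ]
  simp only [map_add, map_smul, dyadicMean_one, smul_eq_mul]
  ring

lemma sharp_invTwoPow : sharp α β (invTwoPow n) = ∑ k ∈ Finset.range (2 ^ n),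
    (α (dyadicPt n (k + 1)) - α (dyadicPt n k)) * (β (dyadicPt n (k + 1)) - β (dyadicPt n k)) := by
  induction n generalizing α β with
  | zero =>
    have h1 : dyadicPt 0 1 = onePt := dyadicPt_two_pow
    simp [invTwoPow_zero, sharp_onePt, dyadicPt_zero, h1]
  | succ n ih =>
    rw [invTwoPow_succ, sharp_half _ _ _ invTwoPow_ne_zeroPt, ih, ih, pow_succ, mul_two,
      Finset.sum_range_add]
    congr 1 <;> refine Finset.sum_congr rfl fun k hk => ?_
    all_goals
      have hk := Finset.mem_range.1 hk
      simp only [T₀, T₁, half_dyadicPt hk.le, half_dyadicPt (Nat.succ_le_of_lt hk),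
        halfAdd_dyadicPt hk.le, halfAdd_dyadicPt (Nat.succ_le_of_lt hk), add_assoc]

lemma sum_range_linear_mul_sub (b : ℕ → ℚ) (c : ℚ) (M : ℕ) :
    ∑ k ∈ Finset.range M, (c - 1 - 2 * k) * (b (k + 1) - b k)
      = (c + 1 - 2 * M) * b M - (c + 1) * b 0 + 2 * ∑ k ∈ Finset.range M, b k := by
  induction M with
  | zero => simp
  | succ M ih =>
    rw [Finset.sum_range_succ, Finset.sum_range_succ, ih]
    push_cast
    ring

-- Abel summation; the second difference of `ε` on the grid of mesh `2⁻ⁿ` is constant.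
lemma eps_sharp_invTwoPow (h0 : β zeroPt = 0) (h1 : β onePt = 0) :
    sharp eps β (invTwoPow n) = 2 * dyadicMean n β / 2 ^ n := by
  set N : ℕ := 2 ^ n with hN
  have hslope (k : ℕ) (hk : k < N) :
      eps (dyadicPt n (k + 1)) - eps (dyadicPt n k) = ((N : ℚ) - 1 - 2 * k) / N ^ 2 := by
    simp only [eps, coe_dyadicPt hk.le, coe_dyadicPt (Nat.succ_le_of_lt hk), hN]
    push_cast
    field_simp
    ring
  calc sharp eps β (invTwoPow n)
      = (∑ k ∈ Finset.range N, ((N : ℚ) - 1 - 2 * k)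
          * (β (dyadicPt n (k + 1)) - β (dyadicPt n k))) / N ^ 2 := by
        rw [sharp_invTwoPow, Finset.sum_div]
        refine Finset.sum_congr rfl fun k hk => ?_
        rw [hslope k (Finset.mem_range.1 hk), div_mul_eq_mul_div]
    _ = 2 * (∑ k ∈ Finset.range N, β (dyadicPt n k)) / N ^ 2 := by
        rw [sum_range_linear_mul_sub fun k => β (dyadicPt n k), hN, dyadicPt_zero,
          dyadicPt_two_pow, h0, h1]
        simp
    _ = 2 * dyadicMean n β / 2 ^ n := by
        rw [dyadicMean_apply, hN]
        push_cast
        field_simp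

end DyadicMean

section Limit

/-- The smaller root `8 - 3√7` of `ρ² - 16ρ + 1`. -/
noncomputable def phiRoot : ℝ := 8 - 3 * √7

lemma phiRoot_sq : phiRoot ^ 2 = 16 * phiRoot - 1 := by
  have h : √7 ^ 2 = (7 : ℝ) := Real.sq_sqrt (by norm_num)
  rw [phiRoot]
  linear_combination 9 * h

lemma phiRoot_mem_Icc : phiRoot ∈ Set.Icc 0 1 := by
  have h : √7 ^ 2 = (7 : ℝ) := Real.sq_sqrt (by norm_num)
  have h0 : (0 : ℝ) ≤ √7 := Real.sqrt_nonneg 7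
  rw [phiRoot]
  constructor <;> nlinarith

/-- The limit of `dyadicMean n (phi m)`, that is `∫₀¹ φ_m`. It solves
`16 L_{m+1} = L_{m+2} + L_m + 1/6 + (4m + 7)`: an affine particular solution plus a multiple of the
homogeneous solution `ρ^m` that stays bounded, the multiple being forced by
`16 L₀ = L₁ + L₀ + 3`. -/
noncomputable def phiLimit (m : ℕ) : ℝ :=
  2 / 7 * m + 19 / 84 + 5 / 42 * (15 - phiRoot)⁻¹ * phiRoot ^ m

variable (m n : ℕ)

lemma sixteen_mul_phiLimit_zero : 16 * phiLimit 0 = phiLimit 1 + phiLimit 0 + 3 := by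
  have h : 15 - phiRoot ≠ 0 := by linarith [phiRoot_mem_Icc.2]
  simp only [phiLimit]
  push_cast
  field_simp
  ring

lemma sixteen_mul_phiLimit_succ :
    16 * phiLimit (m + 1) = phiLimit (m + 2) + phiLimit m + 1 / 6 + (4 * m + 7) := by
  simp only [phiLimit]
  push_cast
  linear_combination (-5 / 42 * (15 - phiRoot)⁻¹ * phiRoot ^ m) * phiRoot_sq

lemma two_mul_phiLimit_zero : 2 * phiLimit 0 = 1 / 3 + 5 / (14 * √7) := by
  have h : √7 ^ 2 = (7 : ℝ) := Real.sq_sqrt (by norm_num)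
  have hinv : (15 - phiRoot)⁻¹ = 3 / (2 * √7) - 1 / 2 := by
    refine inv_eq_of_mul_eq_one_right ?_
    rw [phiRoot]
    field_simp
    linear_combination -3 * h
  rw [phiLimit, hinv]
  push_cast
  ring

lemma abs_phiLimit_le : |phiLimit m| ≤ m + 1 := by
  obtain ⟨h0, h1⟩ := phiRoot_mem_Icc
  have hcoeff : 5 / 42 * (15 - phiRoot)⁻¹ ≤ 1 / 2 := by
    rw [← div_eq_mul_inv, div_le_div_iff₀ (by linarith) (by norm_num)]
    linarith
  have hcoeff0 : 0 ≤ 5 / 42 * (15 - phiRoot)⁻¹ :=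
    mul_nonneg (by norm_num) (inv_nonneg.2 (by linarith))
  have hhom0 := mul_nonneg hcoeff0 (pow_nonneg h0 m)
  have hhom := mul_le_of_le_one_right hcoeff0 (pow_le_one₀ h0 h1 (n := m))
  rw [phiLimit, abs_of_nonneg (by linarith [m.cast_nonneg (α := ℝ)])]
  linarith [m.cast_nonneg (α := ℝ)]

lemma dyadicMean_succ_phi_zero_sub : (dyadicMean (n + 1) (phi 0) : ℝ) - phiLimit 0
    = ((dyadicMean n (phi 1) - phiLimit 1) + (dyadicMean n (phi 0) - phiLimit 0)) / 16 := by
  rw [dyadicMean_succ_phi_zero]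
  push_cast
  linear_combination -sixteen_mul_phiLimit_zero / 16

lemma dyadicMean_succ_phi_succ_sub :
    (dyadicMean (n + 1) (phi (m + 1)) : ℝ) - phiLimit (m + 1)
      = ((dyadicMean n (phi (m + 2)) - phiLimit (m + 2)) + (dyadicMean n (phi m) - phiLimit m)
        + -(1 / 6 * (1 / 4) ^ n)) / 16 := by
  rw [dyadicMean_succ_phi_succ, dyadicMean_eps]
  push_cast
  linear_combination -sixteen_mul_phiLimit_succ m / 16

lemma abs_dyadicMean_phi_sub_le :
    |(dyadicMean n (phi m) : ℝ) - phiLimit m| ≤ (m + 1) * (1 / 2) ^ n := by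
  induction n generalizing m with
  | zero => simpa [dyadicMean_zero, phi_zeroPt] using abs_phiLimit_le m
  | succ n ih =>
    have hp : (0 : ℝ) ≤ (1 / 2) ^ n := by positivity
    cases m with
    | zero =>
      rw [dyadicMean_succ_phi_zero_sub, abs_div, abs_of_pos (by norm_num : (0 : ℝ) < 16), pow_succ]
      have htri := abs_add_le ((dyadicMean n (phi 1) : ℝ) - phiLimit 1)
        (dyadicMean n (phi 0) - phiLimit 0)
      have h0 := ih 0
      have h1 := ih 1
      push_cast at h0 h1 ⊢
      linarith
    | succ m =>
      rw [dyadicMean_succ_phi_succ_sub, abs_div, abs_of_pos (by norm_num : (0 : ℝ) < 16), pow_succ]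
      have htri := abs_add_three ((dyadicMean n (phi (m + 2)) : ℝ) - phiLimit (m + 2))
        (dyadicMean n (phi m) - phiLimit m) (-(1 / 6 * (1 / 4) ^ n))
      have heps : |-(1 / 6 * (1 / 4 : ℝ) ^ n)| ≤ (1 / 2) ^ n := by
        rw [abs_neg, abs_of_nonneg (by positivity)]
        have : (1 / 4 : ℝ) ^ n ≤ (1 / 2) ^ n := by gcongr; norm_num
        linarith
      have h0 := ih m
      have h2 := ih (m + 2)
      have hm : 0 ≤ (m : ℝ) * (1 / 2) ^ n := by positivity
      push_cast at h0 h2 ⊢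
      linarith

lemma tendsto_dyadicMean_phi :
    Tendsto (fun n => (dyadicMean n (phi m) : ℝ)) atTop (𝓝 (phiLimit m)) := by
  refine tendsto_iff_norm_sub_tendsto_zero.2
    (squeeze_zero (fun _ => norm_nonneg _) (abs_dyadicMean_phi_sub_le m) ?_)
  simpa using (tendsto_pow_atTop_nhds_zero_of_lt_one (r := (1 / 2 : ℝ)) (by norm_num)
    (by norm_num)).const_mul ((m : ℝ) + 1)

lemma tendsto_dyadicMean_idFun :
    Tendsto (fun n => (dyadicMean n idFun : ℝ)) atTop (𝓝 (1 / 2)) := by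
  have h : Tendsto (fun n : ℕ => (1 / 2 : ℝ) ^ n) atTop (𝓝 0) :=
    tendsto_pow_atTop_nhds_zero_of_lt_one (by norm_num) (by norm_num)
  simpa [dyadicMean_idFun] using (h.const_sub 1).div_const 2

lemma tendsto_two_pow_mul_E₁ :
    Tendsto (fun n => (2 : ℝ) ^ n * (E₁ (invTwoPow n) : ℝ)) atTop (𝓝 (2 * phiLimit 0)) := by
  refine ((tendsto_dyadicMean_phi 0).const_mul 2).congr fun n => ?_
  rw [E₁, eps_sharp_invTwoPow n _ (phi_zeroPt 0) (phi_onePt 0)]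
  push_cast
  field_simp

end Limit

open MvPowerSeries (coeff monomial expand)

lemma finrank_quotient_eq_sum {F A B ι : Type*} [Field F] [CommRing A] [CommRing B] [Algebra F A]
    [Algebra F B] [Fintype ι] {I : Ideal A} {K : ι → Ideal B} [∀ i, Module.Finite F (B ⧸ K i)]
    (f : A →ₗ[F] ι → B) (g : (ι → B) →ₗ[F] A)
    (hf : ∀ a ∈ I, ∀ i, f a i ∈ K i) (hg : ∀ v, (∀ i, v i ∈ K i) → g v ∈ I)
    (hfg : ∀ v i, f (g v) i - v i ∈ K i) (hgf : ∀ a, a - g (f a) ∈ I) :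
    Module.finrank F (A ⧸ I) = ∑ i, Module.finrank F (B ⧸ K i) := by
  let reduce : (ι → B) →ₗ[F] ∀ i, B ⧸ K i :=
    LinearMap.pi fun i => (Ideal.Quotient.mkₐ F (K i)).toLinearMap ∘ₗ LinearMap.proj i
  have hreduce (v : ι → B) : reduce v = 0 ↔ ∀ i, v i ∈ K i :=
    funext_iff.trans (forall_congr' fun _ => Ideal.Quotient.eq_zero_iff_mem)
  have hker : LinearMap.ker (reduce ∘ₗ f) = I.restrictScalars F := by
    ext a
    rw [LinearMap.mem_ker, LinearMap.comp_apply, hreduce, Submodule.restrictScalars_mem]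
    refine ⟨fun h => ?_, hf a⟩
    rw [← sub_add_cancel a (g (f a))]
    exact I.add_mem (hgf a) (hg _ h)
  have hsurj : Function.Surjective (reduce ∘ₗ f) := fun y => by
    choose v hv using fun i => Ideal.Quotient.mk_surjective (y i)
    exact ⟨g v, funext fun i => (Ideal.Quotient.eq.2 (hfg v i)).trans (hv i)⟩
  rw [← Module.finrank_pi_fintype F, ← ((reduce ∘ₗ f).quotKerEquivOfSurjective hsurj).finrank_eq,
    hker, (Submodule.Quotient.restrictScalarsEquiv F I).finrank_eq]

section BoundedExponents

variable {σ : Type*} [Finite σ] {q : ℕ}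

/-- The exponent vector of a monomial whose exponents are all `< q`. -/
noncomputable def boundedExp (e : σ → Fin q) : σ →₀ ℕ :=
  Finsupp.equivFunOnFinite.symm fun j => (e j : ℕ)

lemma boundedExp_apply (e : σ → Fin q) (j : σ) : boundedExp e j = e j := rfl

lemma boundedExp_injective : Function.Injective (boundedExp : (σ → Fin q) → σ →₀ ℕ) :=
  fun _ _ h => funext fun j => Fin.ext (DFunLike.congr_fun h j)

lemma exists_boundedExp_eq {m : σ →₀ ℕ} (hm : ∀ j, m j < q) : ∃ e : σ → Fin q, boundedExp e = m :=
  ⟨fun j => ⟨m j, hm j⟩, Finsupp.ext fun _ => rfl⟩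

lemma exists_smul_add_boundedExp_eq (hq : q ≠ 0) (m : σ →₀ ℕ) :
    ∃ (m' : σ →₀ ℕ) (e : σ → Fin q), q • m' + boundedExp e = m :=
  ⟨Finsupp.equivFunOnFinite.symm fun j => m j / q,
    fun j => ⟨m j % q, Nat.mod_lt _ (Nat.pos_of_ne_zero hq)⟩,
    Finsupp.ext fun j => by simp [boundedExp_apply, Nat.div_add_mod]⟩

lemma smul_add_boundedExp_inj {m m' : σ →₀ ℕ} {e e' : σ → Fin q} :
    q • m + boundedExp e = q • m' + boundedExp e' ↔ m = m' ∧ e = e' := by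
  refine ⟨fun h => ?_, by rintro ⟨rfl, rfl⟩; rfl⟩
  have hj (j : σ) : q * m j + e j = q * m' j + e' j := by
    simpa [boundedExp_apply] using DFunLike.congr_fun h j
  have he : e = e' := funext fun j => Fin.ext <| by
    simpa [Nat.mod_eq_of_lt (e j).2, Nat.mod_eq_of_lt (e' j).2] using congrArg (· % q) (hj j)
  refine ⟨Finsupp.ext fun j => ?_, he⟩
  have := hj j
  rw [he, add_left_inj] at this
  exact Nat.eq_of_mul_eq_mul_left (e j).pos this

end BoundedExponents

/-- The ideal generated by the `q`-th powers of the variables. -/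
noncomputable def powIdeal (σ R : Type*) [CommRing R] (q : ℕ) : Ideal (MvPowerSeries σ R) :=
  Ideal.span (Set.range fun j : σ => (MvPowerSeries.X j : MvPowerSeries σ R) ^ q)

section PowIdeal

variable {σ R : Type*} [CommRing R] {q : ℕ} {g : MvPowerSeries σ R}

lemma X_pow_mem_powIdeal (j : σ) : (MvPowerSeries.X j : MvPowerSeries σ R) ^ q ∈ powIdeal σ R q :=
  Ideal.subset_span ⟨j, rfl⟩

lemma deg_eq {F : Type*} [Field F] (q : ℕ) (g : MvPowerSeries σ F) :
    deg q g = Module.finrank F (MvPowerSeries σ F ⧸ (powIdeal σ F q ⊔ Ideal.span {g})) := rfl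

variable [Finite σ]

lemma mem_powIdeal_iff :
    g ∈ powIdeal σ R q ↔ ∀ m : σ →₀ ℕ, (∀ j, m j < q) → coeff m g = 0 := by
  classical
  have := Fintype.ofFinite σ
  constructor
  · intro hg m hm
    obtain ⟨c, rfl⟩ := Ideal.mem_span_range_iff_exists_fun.1 hg
    rw [map_sum]
    exact Finset.sum_eq_zero fun j _ =>
      MvPowerSeries.X_pow_dvd_iff.1 (dvd_mul_left (MvPowerSeries.X j ^ q) (c j)) m (hm j)
  · intro hg
    -- Assign every monomial outside the box `[0, q)^σ` to one coordinate where it is large.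
    let part (j : σ) : MvPowerSeries σ R := fun m =>
      if h : ∃ i, q ≤ m i then if h.choose = j then coeff m g else 0 else 0
    have hpart (j : σ) : part j ∈ powIdeal σ R q := by
      refine Ideal.mem_of_dvd _ (MvPowerSeries.X_pow_dvd_iff.2 fun m hm => ?_)
        (X_pow_mem_powIdeal j)
      change dite _ _ _ = _
      split_ifs with h hj
      · exact absurd h.choose_spec (by rw [hj]; exact not_le.2 hm)
      all_goals rfl
    have hsum : g = ∑ j, part j := by
      ext m
      have (j : σ) : coeff m (part j)
        = if h : ∃ i, q ≤ m i then if h.choose = j then coeff m g else 0 else 0 := rfl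
      simp only [map_sum, this]
      split_ifs with h
      · simp
      · simpa using hg m (by simpa using h)
    exact hsum ▸ sum_mem fun j _ => hpart j

instance finite_quotient_powIdeal_sup (I : Ideal (MvPowerSeries σ R)) :
    Module.Finite R (MvPowerSeries σ R ⧸ (powIdeal σ R q ⊔ I)) := by
  classical
  have := Fintype.ofFinite σ
  refine Module.Finite.of_surjective
    ((Ideal.Quotient.mkₐ R (powIdeal σ R q ⊔ I)).toLinearMap ∘ₗ
      Fintype.linearCombination R fun e : σ → Fin q => monomial (boundedExp e) (1 : R)) fun y => ?_
  obtain ⟨g, rfl⟩ := Ideal.Quotient.mk_surjective y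
  refine ⟨fun e => coeff (boundedExp e) g,
    Ideal.Quotient.eq.2 (Ideal.mem_sup_left (mem_powIdeal_iff.2 fun m hm => ?_))⟩
  obtain ⟨e, rfl⟩ := exists_boundedExp_eq hm
  simp [Fintype.linearCombination_apply, MvPowerSeries.coeff_monomial, boundedExp_injective.eq_iff]

end PowIdeal

section Expand

variable {σ R : Type*} [CommRing R] {Q : ℕ} (hQ : Q ≠ 0)

lemma powIdeal_map_expand (q : ℕ) :
    (powIdeal σ R q).map (expand Q hQ) = powIdeal σ R (Q * q) := by
  rw [powIdeal, powIdeal, Ideal.map_span, ← Set.range_comp]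
  congr 2
  ext1 j
  simp [pow_mul]

section Finite

variable [Finite σ] (e : σ → Fin Q) (m : σ →₀ ℕ) (g p : MvPowerSeries σ R)

variable (σ R Q) in
/-- The splitting of a power series `g` into parts, one for each residue class `e` modulo `Q` of
exponents: the part `gₑ` is such that `uᵉ gₑ(u^Q)` collects the terms of `g` in that class. -/
noncomputable def residueParts :
    MvPowerSeries σ R →ₗ[R] (σ → Fin Q) → MvPowerSeries σ R :=
  LinearMap.pi fun e => LinearMap.pi fun m => coeff (Q • m + boundedExp e)

lemma coeff_residueParts :
    coeff m (residueParts σ R Q g e) = coeff (Q • m + boundedExp e) g := rfl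

lemma coeff_monomial_mul_expand_self :
    coeff (Q • m + boundedExp e) (monomial (boundedExp e) 1 * expand Q hQ p) = coeff m p := by
  rw [add_comm, MvPowerSeries.coeff_add_monomial_mul, one_mul, MvPowerSeries.coeff_expand_smul]

lemma coeff_monomial_mul_expand_of_ne {e' : σ → Fin Q} (he : e ≠ e') :
    coeff (Q • m + boundedExp e) (monomial (boundedExp e') 1 * expand Q hQ p) = 0 := by
  classical
  rw [MvPowerSeries.coeff_monomial_mul, one_mul]
  refine ite_eq_right_iff.2 fun hle => ?_
  by_contra hc
  have hdvd (j : σ) : Q ∣ (Q • m + boundedExp e - boundedExp e') j := by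
    by_contra hj
    exact hc (MvPowerSeries.coeff_expand_of_not_dvd Q hQ p hj)
  choose m' hm' using hdvd
  have heq : Q • m + boundedExp e = Q • Finsupp.equivFunOnFinite.symm m' + boundedExp e' := by
    rw [← tsub_eq_iff_eq_add_of_le hle]
    exact Finsupp.ext hm'
  exact he (smul_add_boundedExp_inj.1 heq).2

end Finite

section Fintype

variable [Fintype σ] [DecidableEq σ] (g p : MvPowerSeries σ R)
  (v : (σ → Fin Q) → MvPowerSeries σ R)

/-- The inverse of `residueParts`, `v ↦ ∑ₑ uᵉ vₑ(u^Q)`. -/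
noncomputable def ofResidueParts :
    ((σ → Fin Q) → MvPowerSeries σ R) →ₗ[R] MvPowerSeries σ R :=
  ∑ e, LinearMap.mulLeft R (monomial (boundedExp e) 1) ∘ₗ (expand Q hQ).toLinearMap ∘ₗ
    LinearMap.proj e

lemma ofResidueParts_apply :
    ofResidueParts hQ v = ∑ e, monomial (boundedExp e) 1 * expand Q hQ (v e) := by
  simp [ofResidueParts]

lemma ofResidueParts_smul : ofResidueParts hQ (p • v) = expand Q hQ p * ofResidueParts hQ v := by
  simp only [ofResidueParts_apply, Pi.smul_apply, smul_eq_mul, map_mul, Finset.mul_sum,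
    mul_left_comm]

lemma residueParts_ofResidueParts : residueParts σ R Q (ofResidueParts hQ v) = v := by
  ext e m
  rw [coeff_residueParts, ofResidueParts_apply, map_sum, Finset.sum_eq_single e,
    coeff_monomial_mul_expand_self]
  · exact fun e' _ he => coeff_monomial_mul_expand_of_ne hQ e m _ he.symm
  · exact fun he => absurd (Finset.mem_univ e) he

lemma ofResidueParts_residueParts : ofResidueParts hQ (residueParts σ R Q g) = g := by
  ext m
  obtain ⟨m, e, rfl⟩ := exists_smul_add_boundedExp_eq hQ m
  rw [← coeff_residueParts, residueParts_ofResidueParts, coeff_residueParts]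

end Fintype

lemma residueParts_expand_mul [Finite σ] (g p : MvPowerSeries σ R) :
    residueParts σ R Q (expand Q hQ p * g) = p • residueParts σ R Q g := by
  classical
  have := Fintype.ofFinite σ
  conv_lhs => rw [← ofResidueParts_residueParts hQ g, ← ofResidueParts_smul,
    residueParts_ofResidueParts]

lemma residueParts_mem_of_mem_map_expand [Finite σ] {K : Ideal (MvPowerSeries σ R)}
    {g : MvPowerSeries σ R} (hg : g ∈ K.map (expand Q hQ)) (e : σ → Fin Q) :
    residueParts σ R Q g e ∈ K := by
  -- `residueParts` is only `R`-linear, so the induction carries all multiples of `g` along.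
  suffices h : ∀ c, residueParts σ R Q (c * g) e ∈ K by simpa using h 1
  induction hg using Submodule.span_induction with
  | mem x hx =>
    obtain ⟨p, hp, rfl⟩ := hx
    intro c
    rw [mul_comm]
    exact congrFun (residueParts_expand_mul hQ c p) e ▸ K.mul_mem_right _ hp
  | zero => simp
  | add x y _ _ hx hy =>
    intro c
    rw [mul_add, map_add]
    exact K.add_mem (hx c) (hy c)
  | smul a x _ hx =>
    intro c
    rw [smul_eq_mul, ← mul_assoc]
    exact hx (c * a)

variable [Fintype σ] {F : Type*} [Field F]

lemma finrank_quotient_map_expand (K : Ideal (MvPowerSeries σ F))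
    [Module.Finite F (MvPowerSeries σ F ⧸ K)] :
    Module.finrank F (MvPowerSeries σ F ⧸ K.map (expand Q hQ))
      = Q ^ Fintype.card σ * Module.finrank F (MvPowerSeries σ F ⧸ K) := by
  classical
  have hof (v : (σ → Fin Q) → MvPowerSeries σ F) (hv : ∀ e, v e ∈ K) :
      ofResidueParts hQ v ∈ K.map (expand Q hQ) := by
    rw [ofResidueParts_apply]
    exact sum_mem fun e _ => Ideal.mul_mem_left _ _ (Ideal.mem_map_of_mem _ (hv e))
  rw [finrank_quotient_eq_sum (K := fun _ : σ → Fin Q => K) (residueParts σ F Q)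
    (ofResidueParts hQ) (fun g => residueParts_mem_of_mem_map_expand hQ) hof
    (fun v e => by rw [residueParts_ofResidueParts, sub_self]; exact K.zero_mem)
    fun g => by rw [ofResidueParts_residueParts, sub_self]; exact Ideal.zero_mem _]
  simp

lemma deg_expand (q : ℕ) (f : MvPowerSeries σ F) :
    deg (Q * q) (expand Q hQ f) = Q ^ Fintype.card σ * deg q f := by
  rw [deg_eq, deg_eq, ← finrank_quotient_map_expand hQ, Ideal.map_sup, powIdeal_map_expand,
    Ideal.map_span, Set.image_singleton]

end Expand

section Frobenius

variable {σ F : Type*} [Fintype σ] [Field F] {f : MvPowerSeries σ F}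

lemma deg_pow_char_mul {p : ℕ} [ExpChar F p] (hf : MvPowerSeries.map (frobenius F p) f = f)
    (q i : ℕ) : deg (p * q) (f ^ (p * i)) = p ^ Fintype.card σ * deg q (f ^ i) := by
  have hp := expChar_ne_zero F p
  have hexpand : expand p hp f = f ^ p := by
    rw [← MvPowerSeries.map_frobenius_expand p hp, MvPowerSeries.map_expand, hf]
  rw [← deg_expand hp, map_pow, hexpand, pow_mul]

lemma hkFun_of_coprime {t : dyadicUnit} {a b : ℕ} (hb : 0 < b) (hab : a.Coprime b)
    (ht : t.1 = a / b) :
    hkFun f t = deg b (f ^ a) / (b : ℚ) ^ Fintype.card σ := by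
  have hab' : (a : ℤ).natAbs.Coprime (b : ℤ).natAbs := by simpa using hab
  have hnum : t.1.num = a := by
    simpa [ht] using Rat.num_div_eq_of_coprime (Int.natCast_pos.2 hb) hab'
  have hden : t.1.den = b := by
    simpa [ht] using Rat.den_div_eq_of_coprime (Int.natCast_pos.2 hb) hab'
  rw [hkFun, hnum, hden, Int.toNat_natCast]

lemma hkFun_dyadicPt [CharP F 2] (hf : MvPowerSeries.map (frobenius F 2) f = f) {n k : ℕ}
    (hk : k ≤ 2 ^ n) :
    hkFun f (dyadicPt n k) = deg (2 ^ n) (f ^ k) / ((2 : ℚ) ^ n) ^ Fintype.card σ := by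
  induction n generalizing k with
  | zero => simpa using hkFun_of_coprime one_pos (Nat.coprime_one_right k) (coe_dyadicPt hk)
  | succ n ih =>
    rcases Nat.even_or_odd' k with ⟨i, rfl | rfl⟩
    · have hi : i ≤ 2 ^ n := by rw [pow_succ] at hk; omega
      rw [dyadicPt_two_mul hi, ih hi, pow_succ' 2 n, deg_pow_char_mul hf, pow_succ', mul_pow]
      push_cast
      field_simp
    · have hcop : (2 * i + 1).Coprime (2 ^ (n + 1)) :=
        Nat.Coprime.pow_right _ (Nat.coprime_two_right.2 (odd_two_mul_add_one i))
      simpa using hkFun_of_coprime (f := f) (by positivity) hcop (by simpa using coe_dyadicPt hk)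

end Frobenius

section TwoMoreVariables

variable {F : Type*} [Field F] {r : ℕ}

section Coefficients

variable (a b : ℕ) (p : MvPowerSeries (Fin r) F) (g : MvPowerSeries (Fin (r + 2)) F)

/-- The coefficient of `uᵃ vᵇ` of a power series in `u`, `v` and `r` further variables. -/
noncomputable def coeffUV :
    MvPowerSeries (Fin (r + 2)) F →ₗ[F] MvPowerSeries (Fin r) F :=
  LinearMap.pi fun m => coeff ((m.cons b).cons a)

lemma coeff_coeffUV (m : Fin r →₀ ℕ) :
    coeff m (coeffUV a b g) = coeff ((m.cons b).cons a) g := rfl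

lemma coeffUV_eq_coeff_coeff :
    coeffUV a b g = PowerSeries.coeff b (MvPowerSeries.finSuccEquiv F r
      (PowerSeries.coeff a (MvPowerSeries.finSuccEquiv F (r + 1) g))) := by
  ext m
  rw [MvPowerSeries.coeff_coeff_finSuccEquiv, MvPowerSeries.coeff_coeff_finSuccEquiv,
    coeff_coeffUV]

/-- The inclusion of the power series in the last `r` of `r + 2` variables. -/
noncomputable def inclLast : MvPowerSeries (Fin r) F →ₐ[F] MvPowerSeries (Fin (r + 2)) F :=
  ((MvPowerSeries.finSuccEquiv F (r + 1)).symm.toAlgHom.comp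
    (IsScalarTower.toAlgHom F _ (PowerSeries _))).comp
  ((MvPowerSeries.finSuccEquiv F r).symm.toAlgHom.comp
    (IsScalarTower.toAlgHom F _ (PowerSeries _)))

lemma inclLast_eq : inclLast p = (MvPowerSeries.finSuccEquiv F (r + 1)).symm
    (PowerSeries.C ((MvPowerSeries.finSuccEquiv F r).symm (PowerSeries.C p))) := rfl

lemma inclLast_X (j : Fin r) :
    inclLast (MvPowerSeries.X j : MvPowerSeries (Fin r) F) = MvPowerSeries.X j.succ.succ := by
  rw [inclLast_eq, AlgEquiv.symm_apply_eq, MvPowerSeries.finSuccEquiv_X_succ,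
    ← MvPowerSeries.finSuccEquiv_X_succ, AlgEquiv.symm_apply_apply]

lemma coeffUV_inclLast_mul : coeffUV a b (inclLast p * g) = p * coeffUV a b g := by
  simp only [coeffUV_eq_coeff_coeff, inclLast_eq, map_mul, AlgEquiv.apply_symm_apply,
    PowerSeries.coeff_C_mul]

lemma coeffUV_one :
    coeffUV a b (1 : MvPowerSeries (Fin (r + 2)) F) = if a = 0 ∧ b = 0 then 1 else 0 := by
  simp only [coeffUV_eq_coeff_coeff, map_one, PowerSeries.coeff_one, ite_and]
  split_ifs <;> simp [*]

lemma coeffUV_X_pow_mul_X_pow_mul (i j : ℕ) :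
    coeffUV a b (MvPowerSeries.X 0 ^ i * MvPowerSeries.X 1 ^ j * g)
      = if i ≤ a ∧ j ≤ b then coeffUV (a - i) (b - j) g else 0 := by
  have hX₁ : MvPowerSeries.finSuccEquiv F (r + 1) (MvPowerSeries.X 1)
      = PowerSeries.C (MvPowerSeries.X 0) := MvPowerSeries.finSuccEquiv_X_succ (R := F) 0
  rw [coeffUV_eq_coeff_coeff, mul_assoc, map_mul, map_pow, MvPowerSeries.finSuccEquiv_X_zero,
    PowerSeries.coeff_X_pow_mul', ite_and]
  by_cases hi : i ≤ a
  · rw [if_pos hi, if_pos hi, map_mul, map_pow, hX₁, ← map_pow, PowerSeries.coeff_C_mul, map_mul,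
      map_pow, MvPowerSeries.finSuccEquiv_X_zero, PowerSeries.coeff_X_pow_mul',
      coeffUV_eq_coeff_coeff]
  · rw [if_neg hi, if_neg hi, map_zero, map_zero]

/-- The power series `uᵃ vᵇ p`, where `p` does not involve `u` and `v`. -/
noncomputable def uvTerm : MvPowerSeries (Fin r) F →ₗ[F] MvPowerSeries (Fin (r + 2)) F :=
  LinearMap.mulLeft F (MvPowerSeries.X 0 ^ a * MvPowerSeries.X 1 ^ b) ∘ₗ inclLast.toLinearMap

lemma uvTerm_apply :
    uvTerm a b p = MvPowerSeries.X 0 ^ a * MvPowerSeries.X 1 ^ b * inclLast p := rfl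

lemma coeffUV_uvTerm (i j : ℕ) : coeffUV a b (uvTerm i j p) = if a = i ∧ b = j then p else 0 := by
  rw [uvTerm_apply, coeffUV_X_pow_mul_X_pow_mul, ← mul_one (inclLast p), coeffUV_inclLast_mul,
    coeffUV_one, mul_ite, mul_one, mul_zero, ← ite_and]
  exact if_congr (by omega) rfl rfl

end Coefficients

section PowIdeal

variable {a b q : ℕ} {p : MvPowerSeries (Fin r) F} {g : MvPowerSeries (Fin (r + 2)) F}

lemma mem_powIdeal_iff_coeffUV :
    g ∈ powIdeal (Fin (r + 2)) F q
      ↔ ∀ a < q, ∀ b < q, coeffUV a b g ∈ powIdeal (Fin r) F q := by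
  simp only [mem_powIdeal_iff, coeff_coeffUV]
  constructor
  · intro h a ha b hb m hm
    refine h _ (Fin.cases ?_ (Fin.cases ?_ fun j => ?_))
    · rwa [Finsupp.cons_zero]
    · rwa [Finsupp.cons_succ, Finsupp.cons_zero]
    · rw [Finsupp.cons_succ, Finsupp.cons_succ]
      exact hm j
  · intro h m hm
    have := h (m 0) (hm 0) (m.tail 0) (hm _) m.tail.tail fun j => hm _
    rwa [Finsupp.cons_tail, Finsupp.cons_tail] at this

lemma uvTerm_mem_powIdeal (hp : p ∈ powIdeal (Fin r) F q) :
    uvTerm a b p ∈ powIdeal (Fin (r + 2)) F q :=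
  mem_powIdeal_iff_coeffUV.2 fun i _ j _ => by
    rw [coeffUV_uvTerm]
    split_ifs
    exacts [hp, Ideal.zero_mem _]

lemma uvTerm_mem_powIdeal_of_le (hab : q ≤ a ∨ q ≤ b) :
    uvTerm a b p ∈ powIdeal (Fin (r + 2)) F q :=
  mem_powIdeal_iff_coeffUV.2 fun i hi j hj => by
    rw [coeffUV_uvTerm, if_neg (by omega)]
    exact Ideal.zero_mem _

end PowIdeal

/-- Indices for the diagonals `{(fst + j, snd + j) | j < len}` that partition the square
`[0, q)²` of exponents of `u` and `v`. The last of the diagonals `inr i` is empty. -/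
abbrev Diagonal (q : ℕ) : Type := Fin q ⊕ Fin q

namespace Diagonal

variable {q : ℕ} {d d' : Diagonal q} {j j' : ℕ}

/-- The exponent of `u` at the start of a diagonal. -/
def fst : Diagonal q → ℕ := Sum.elim (fun i => i) fun _ => 0

/-- The exponent of `v` at the start of a diagonal. -/
def snd : Diagonal q → ℕ := Sum.elim (fun _ => 0) fun i => i + 1

/-- The number of pairs of exponents on a diagonal. -/
def len (d : Diagonal q) : ℕ := q - (d.fst + d.snd)

lemma fst_eq_zero_or (d : Diagonal q) : d.fst = 0 ∨ d.snd = 0 := by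
  cases d <;> simp [fst, snd]

lemma add_lt_iff : d.fst + j < q ∧ d.snd + j < q ↔ j < d.len := by
  have := d.fst_eq_zero_or
  rw [len]
  omega

lemma eq_of_add_eq (h : d.fst + j = d'.fst + j') (h' : d.snd + j = d'.snd + j') :
    d = d' ∧ j = j' := by
  rcases d with i | i <;> rcases d' with i' | i' <;>
    simp only [fst, snd, Sum.elim_inl, Sum.elim_inr, reduceCtorEq, false_and, Sum.inl.injEq,
      Sum.inr.injEq, Fin.ext_iff] at * <;>
    omega

lemma exists_add_eq {a b : ℕ} (ha : a < q) (hb : b < q) :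
    ∃ (d : Diagonal q) (j : ℕ), d.fst + j = a ∧ d.snd + j = b := by
  rcases le_or_gt b a with h | h
  · exact ⟨.inl ⟨a - b, by omega⟩, b, Nat.sub_add_cancel h, Nat.zero_add b⟩
  · exact ⟨.inr ⟨b - a - 1, by omega⟩, a, Nat.zero_add a,
      by simp only [snd, Sum.elim_inr]; omega⟩

lemma sum_len (h : ℕ → ℕ) :
    ∑ d : Diagonal q, h d.len
      = ∑ k ∈ Finset.range q, h (k + 1) + ∑ k ∈ Finset.range q, h k := by
  rw [Fintype.sum_sum_type, ← Finset.sum_range_reflect _ q, ← Finset.sum_range_reflect h q,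
    Finset.sum_range, Finset.sum_range]
  congr 1 <;> refine Finset.sum_congr rfl fun i _ => congrArg h ?_ <;>
    simp only [len, fst, snd, Sum.elim_inl, Sum.elim_inr] <;> omega

end Diagonal

section UVIdeal

variable (q : ℕ) (f : MvPowerSeries (Fin r) F)

/-- The ideal `(u^q, v^q, …, uv - f)`. -/
noncomputable def uvIdeal : Ideal (MvPowerSeries (Fin (r + 2)) F) :=
  powIdeal _ F q ⊔ Ideal.span {MvPowerSeries.X 0 * MvPowerSeries.X 1 - inclLast f}

/-- The sums `∑ⱼ fʲ nⱼ` over the diagonals, where the `nⱼ` are the coefficients of a power series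
on the diagonal; modulo `uv - f`, the terms of a diagonal add up to its first monomial times this
sum. -/
noncomputable def diagSums :
    MvPowerSeries (Fin (r + 2)) F →ₗ[F] Diagonal q → MvPowerSeries (Fin r) F :=
  LinearMap.pi fun d => ∑ j ∈ Finset.range d.len,
    LinearMap.mulLeft F (f ^ j) ∘ₗ coeffUV (d.fst + j) (d.snd + j)

/-- The power series with prescribed coefficients at the starts of the diagonals, and no other
terms. -/
noncomputable def ofDiagStarts :
    (Diagonal q → MvPowerSeries (Fin r) F) →ₗ[F] MvPowerSeries (Fin (r + 2)) F :=
  ∑ d, uvTerm d.fst d.snd ∘ₗ LinearMap.proj d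

variable {q} {p : MvPowerSeries (Fin r) F} {g : MvPowerSeries (Fin (r + 2)) F} {d : Diagonal q}

lemma diagSums_apply :
    diagSums q f g d = ∑ j ∈ Finset.range d.len, f ^ j * coeffUV (d.fst + j) (d.snd + j) g := by
  simp [diagSums]

lemma ofDiagStarts_apply (v : Diagonal q → MvPowerSeries (Fin r) F) :
    ofDiagStarts q v = ∑ d, uvTerm d.fst d.snd (v d) := by
  simp [ofDiagStarts]

lemma uvTerm_add_sub_mem (a b j : ℕ) :
    uvTerm (a + j) (b + j) p - uvTerm a b (f ^ j * p) ∈ uvIdeal q f := by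
  have h : MvPowerSeries.X 0 * MvPowerSeries.X 1 - inclLast f
      ∣ uvTerm (a + j) (b + j) p - uvTerm a b (f ^ j * p) := by
    convert (sub_dvd_pow_sub_pow _ _ j).mul_left (uvTerm a b p) using 1
    simp only [uvTerm_apply, map_mul, map_pow]
    ring
  exact Ideal.mem_sup_right (Ideal.mem_span_singleton.2 h)

/-- The sum telescopes, and its lower end vanishes as the diagonal starts on an axis. -/
lemma sum_pow_mul_coeffUV_sub_mul {a b : ℕ} (hab : a = 0 ∨ b = 0) (k : ℕ) :
    ∑ j ∈ Finset.range k, f ^ j * coeffUV (a + j) (b + j)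
      ((MvPowerSeries.X 0 * MvPowerSeries.X 1 - inclLast f) * g)
      = -(f ^ k * coeffUV (a + k) (b + k) (MvPowerSeries.X 0 * MvPowerSeries.X 1 * g)) := by
  have hshift (i j : ℕ) : coeffUV i j (MvPowerSeries.X 0 * MvPowerSeries.X 1 * g)
      = if 1 ≤ i ∧ 1 ≤ j then coeffUV (i - 1) (j - 1) g else 0 := by
    simpa only [pow_one] using coeffUV_X_pow_mul_X_pow_mul i j g 1 1
  induction k with
  | zero => rw [Finset.sum_range_zero, hshift, if_neg (by omega), mul_zero, neg_zero]
  | succ k ih =>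
    rw [Finset.sum_range_succ, ih, sub_mul, map_sub, coeffUV_inclLast_mul, hshift (a + (k + 1)),
      if_pos (by omega), ← add_assoc, ← add_assoc, Nat.add_sub_cancel, Nat.add_sub_cancel]
    ring

lemma diagSums_mem (hg : g ∈ uvIdeal q f) (d : Diagonal q) :
    diagSums q f g d ∈ powIdeal (Fin r) F q ⊔ Ideal.span {f ^ d.len} := by
  obtain ⟨g₁, hg₁, g₂, hg₂, rfl⟩ := Submodule.mem_sup.1 hg
  obtain ⟨c, rfl⟩ := Ideal.mem_span_singleton.1 hg₂
  rw [map_add]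
  refine Ideal.add_mem _ (Ideal.mem_sup_left ?_) (Ideal.mem_sup_right ?_) <;>
    rw [diagSums_apply]
  · refine sum_mem fun j hj => Ideal.mul_mem_left _ _ ?_
    obtain ⟨hu, hv⟩ := Diagonal.add_lt_iff.2 (Finset.mem_range.1 hj)
    exact mem_powIdeal_iff_coeffUV.1 hg₁ _ hu _ hv
  · rw [sum_pow_mul_coeffUV_sub_mul f d.fst_eq_zero_or, Ideal.mem_span_singleton, dvd_neg]
    exact dvd_mul_right _ _

lemma uvTerm_mem_uvIdeal (hp : p ∈ powIdeal (Fin r) F q ⊔ Ideal.span {f ^ d.len}) :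
    uvTerm d.fst d.snd p ∈ uvIdeal q f := by
  obtain ⟨p₁, hp₁, p₂, hp₂, rfl⟩ := Submodule.mem_sup.1 hp
  obtain ⟨c, rfl⟩ := Ideal.mem_span_singleton.1 hp₂
  rw [map_add]
  refine Ideal.add_mem _ (Ideal.mem_sup_left (uvTerm_mem_powIdeal hp₁)) ?_
  have hout : q ≤ d.fst + d.len ∨ q ≤ d.snd + d.len := by
    by_contra! h
    exact lt_irrefl _ (Diagonal.add_lt_iff.1 h)
  exact (Submodule.sub_mem_iff_right _ (Ideal.mem_sup_left (uvTerm_mem_powIdeal_of_le hout))).1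
    (uvTerm_add_sub_mem f d.fst d.snd d.len)

lemma ofDiagStarts_mem {v : Diagonal q → MvPowerSeries (Fin r) F}
    (hv : ∀ d, v d ∈ powIdeal (Fin r) F q ⊔ Ideal.span {f ^ d.len}) :
    ofDiagStarts q v ∈ uvIdeal q f := by
  rw [ofDiagStarts_apply]
  exact sum_mem fun d _ => uvTerm_mem_uvIdeal f (hv d)

lemma diagSums_ofDiagStarts_sub_mem (v : Diagonal q → MvPowerSeries (Fin r) F) (d : Diagonal q) :
    diagSums q f (ofDiagStarts q v) d - v d ∈ powIdeal (Fin r) F q ⊔ Ideal.span {f ^ d.len} := by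
  rcases Nat.eq_zero_or_pos d.len with hd | hd
  · simp [hd]
  have hcoeff (j : ℕ) :
      coeffUV (d.fst + j) (d.snd + j) (ofDiagStarts q v) = if j = 0 then v d else 0 := by
    rw [ofDiagStarts_apply, map_sum, Finset.sum_eq_single d, coeffUV_uvTerm]
    · exact if_congr (by omega) rfl rfl
    · intro d' _ hd'
      rw [coeffUV_uvTerm]
      exact if_neg fun h => hd' (Diagonal.eq_of_add_eq (j' := 0) h.1 h.2).1.symm
    · exact fun h => absurd (Finset.mem_univ d) h
  simp [diagSums_apply, hcoeff, hd]

lemma sub_sum_uvTerm_coeffUV_mem (g : MvPowerSeries (Fin (r + 2)) F) :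
    g - ∑ d : Diagonal q, ∑ j ∈ Finset.range d.len,
      uvTerm (d.fst + j) (d.snd + j) (coeffUV (d.fst + j) (d.snd + j) g)
      ∈ powIdeal (Fin (r + 2)) F q := by
  refine mem_powIdeal_iff_coeffUV.2 fun a ha b hb => ?_
  obtain ⟨d, j, rfl, rfl⟩ := Diagonal.exists_add_eq ha hb
  convert Ideal.zero_mem _
  simp only [map_sub, map_sum, coeffUV_uvTerm]
  rw [Finset.sum_eq_single d, Finset.sum_eq_single j, if_pos ⟨rfl, rfl⟩, sub_self]
  · exact fun j' _ hj' => if_neg fun h => hj' (by omega)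
  · exact fun h => absurd (Finset.mem_range.2 (Diagonal.add_lt_iff.1 ⟨ha, hb⟩)) h
  · exact fun d' _ hd' => Finset.sum_eq_zero fun j' _ =>
      if_neg fun h => hd' (Diagonal.eq_of_add_eq h.1 h.2).1.symm
  · exact fun h => absurd (Finset.mem_univ d) h

lemma sub_ofDiagStarts_diagSums_mem (g : MvPowerSeries (Fin (r + 2)) F) :
    g - ofDiagStarts q (diagSums q f g) ∈ uvIdeal q f := by
  have hterms : ∑ d : Diagonal q, ∑ j ∈ Finset.range d.len,
      (uvTerm (d.fst + j) (d.snd + j) (coeffUV (d.fst + j) (d.snd + j) g)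
        - uvTerm d.fst d.snd (f ^ j * coeffUV (d.fst + j) (d.snd + j) g)) ∈ uvIdeal q f :=
    sum_mem fun d _ => sum_mem fun j _ => uvTerm_add_sub_mem f d.fst d.snd j
  have hsum := (uvIdeal q f).add_mem (Ideal.mem_sup_left (sub_sum_uvTerm_coeffUV_mem g)) hterms
  simp only [Finset.sum_sub_distrib, sub_add_sub_cancel] at hsum
  simpa only [ofDiagStarts_apply, diagSums_apply, map_sum] using hsum

variable (q)

lemma deg_uv_sub :
    deg q (MvPowerSeries.X 0 * MvPowerSeries.X 1 - inclLast f)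
      = ∑ k ∈ Finset.range q, deg q (f ^ (k + 1)) + ∑ k ∈ Finset.range q, deg q (f ^ k) := by
  rw [← Diagonal.sum_len fun k => deg q (f ^ k)]
  exact finrank_quotient_eq_sum (I := uvIdeal q f)
    (K := fun d : Diagonal q => powIdeal (Fin r) F q ⊔ Ideal.span {f ^ d.len})
    (diagSums q f) (ofDiagStarts q) (fun _ => diagSums_mem f) (fun _ => ofDiagStarts_mem f)
    (diagSums_ofDiagStarts_sub_mem f) (sub_ofDiagStarts_diagSums_mem f)

end UVIdeal

section HKMultiplicity

variable [CharP F 2] {f : MvPowerSeries (Fin r) F}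

lemma deg_uv_sub_two_pow (hf : MvPowerSeries.map (frobenius F 2) f = f) (n : ℕ) :
    (deg (2 ^ n) (MvPowerSeries.X 0 * MvPowerSeries.X 1 - inclLast f) : ℚ) / (2 ^ n) ^ (r + 1)
      = 2 * dyadicMean n (hkFun f) + (hkFun f onePt - hkFun f zeroPt) / 2 ^ n := by
  have hdeg {k : ℕ} (hk : k ≤ 2 ^ n) :
      (deg (2 ^ n) (f ^ k) : ℚ) = (2 ^ n) ^ r * hkFun f (dyadicPt n k) := by
    rw [hkFun_dyadicPt hf hk, Fintype.card_fin]
    field_simp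
  have hsum : ∑ k ∈ Finset.range (2 ^ n), (deg (2 ^ n) (f ^ k) : ℚ)
      = (2 ^ n) ^ (r + 1) * dyadicMean n (hkFun f) := by
    rw [dyadicMean_apply, Finset.sum_congr rfl fun k hk => hdeg (Finset.mem_range.1 hk).le,
      ← Finset.mul_sum, pow_succ]
    field_simp
  have hshift : ∑ k ∈ Finset.range (2 ^ n), (deg (2 ^ n) (f ^ (k + 1)) : ℚ)
      = ∑ k ∈ Finset.range (2 ^ n), (deg (2 ^ n) (f ^ k) : ℚ)
        + (2 ^ n) ^ r * (hkFun f onePt - hkFun f zeroPt) := by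
    rw [← sub_eq_iff_eq_add', ← Finset.sum_sub_distrib, Finset.sum_range_sub fun k =>
      (deg (2 ^ n) (f ^ k) : ℚ), hdeg le_rfl, hdeg (Nat.zero_le _), dyadicPt_two_pow,
      dyadicPt_zero, mul_sub]
  rw [deg_uv_sub]
  push_cast
  rw [hshift, hsum]
  field_simp
  ring

lemma hasHKMultiplicity_uv_sub (hf : MvPowerSeries.map (frobenius F 2) f = f) {I : ℝ}
    (hI : Tendsto (fun n => (dyadicMean n (hkFun f) : ℝ)) atTop (𝓝 I)) :
    HasHKMultiplicity (MvPowerSeries.X 0 * MvPowerSeries.X 1 - inclLast f) (2 * I) := by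
  have hends : Tendsto (fun n : ℕ => ((hkFun f onePt - hkFun f zeroPt : ℚ) : ℝ) / 2 ^ n)
      atTop (𝓝 0) :=
    tendsto_const_nhds.div_atTop (tendsto_pow_atTop_atTop_of_one_lt one_lt_two)
  have hlim := (hI.const_mul 2).add hends
  rw [add_zero] at hlim
  refine hlim.congr fun n => ?_
  rw [Fintype.card_fin, Nat.add_sub_cancel (m := 1)]
  have := congrArg (Rat.cast : ℚ → ℝ) (deg_uv_sub_two_pow hf n).symm
  push_cast at this ⊢
  exact this

end HKMultiplicity

end TwoMoreVariables

section NodalCubic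

variable {F : Type*} [Field F] [CharP F 2]

lemma map_frobenius_nodalCubic :
    MvPowerSeries.map (frobenius F 2) (nodalCubic F) = nodalCubic F := by
  simp [nodalCubic]

lemma uvNodalCubic_eq_sub : uvNodalCubic F
    = MvPowerSeries.X 0 * MvPowerSeries.X 1 - inclLast (nodalCubic F) := by
  have : CharP (MvPowerSeries (Fin 5) F) 2 :=
    charP_of_injective_algebraMap (algebraMap F (MvPowerSeries (Fin 5) F)).injective 2
  rw [CharTwo.sub_eq_add]
  simp only [uvNodalCubic, nodalCubic, map_add, map_mul, map_pow, inclLast_X, add_assoc]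
  rfl

lemma hasHKMultiplicity_uvNodalCubic (hF : NodalCubicConjecture F) :
    HasHKMultiplicity (uvNodalCubic F) (1 + 2 * phiLimit 0) := by
  have hmean : Tendsto (fun n => (dyadicMean n (hkFun (nodalCubic F)) : ℝ)) atTop
      (𝓝 (1 / 2 + phiLimit 0)) := by
    refine (tendsto_dyadicMean_idFun.add (tendsto_dyadicMean_phi 0)).congr fun n => ?_
    rw [show hkFun (nodalCubic F) = _ from hF, map_add, Rat.cast_add]
  rw [uvNodalCubic_eq_sub]
  convert hasHKMultiplicity_uv_sub map_frobenius_nodalCubic hmean using 1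
  ring

end NodalCubic

end HilbertKunz

theorem theorem2p4 :
    Filter.Tendsto (fun n : ℕ => (2 : ℝ) ^ n * (HilbertKunz.E₁ (HilbertKunz.invTwoPow n) : ℝ))
        Filter.atTop (nhds (1 / 3 + 5 / (14 * Real.sqrt 7))) ∧
      ∀ (F : Type*) [Field F] [CharP F 2], HilbertKunz.NodalCubicConjecture F →
        HilbertKunz.HasHKMultiplicity (HilbertKunz.uvNodalCubic F)
          (4 / 3 + 5 / (14 * Real.sqrt 7)) := by
  refine ⟨?_, fun F _ _ hF => ?_⟩
  · rw [← HilbertKunz.two_mul_phiLimit_zero]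
    exact HilbertKunz.tendsto_two_pow_mul_E₁
  · have hμ := HilbertKunz.hasHKMultiplicity_uvNodalCubic hF
    rwa [HilbertKunz.two_mul_phiLimit_zero, ← add_assoc, show (1 : ℝ) + 1 / 3 = 4 / 3 by norm_num]
      at hμ
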